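/- Let $G$ be a finite group, let $p$ be a prime number, and let $\alpha$ be an automorphism of $G$ whose order $|\alpha|$ is a prime number with $(|G|,|\alpha|)=1$. Let $C_G(\alpha)=\{g\in G : \alpha(g)=g\}$, and let $P$ be a Sylow $p$-subgroup of $G$ with $\alpha(P)=P$. Assume that $p$ does not divide $|C_G(\alpha)|$, and that $G$ is $p$-separable, that is, there is a series $1=N_0\le N_1\le\dots\le N_n=G$ of normal subgroups of $G$ such that each factor $N_{i+1}/N_i$ is either a $p$-group or a group of order prime to $p$. If $C_G(\alpha)$ normalizes $P$, then $G$ is $p$-closed, that is, $G$ has a normal Sylow $p$-subgroup. -/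

import Mathlib

/-- The set `π(G)` of the primes dividing the order of the finite group `G`. -/
noncomputable def primesOf (G : Type*) [Group G] : Finset ℕ :=
  (Nat.card G).primeFactors

/-- `C_G(α)`: the subgroup of the elements of `G` that are fixed by the automorphism `α`. -/
def fixedSubgroup {G : Type*} [Group G] (α : MulAut G) : Subgroup G where
  carrier := {g | α g = g}
  one_mem' := map_one α
  mul_mem' := by
    intro a b ha hb
    simp only [Set.mem_ofPred_eq] at ha hb ⊢
    rw [map_mul, ha, hb]
  inv_mem' := by
    intro a ha
    simp only [Set.mem_ofPred_eq] at ha ⊢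
    rw [map_inv, ha]

/-- `α` is a coprime automorphism of the finite group `G`: `(|G|, |α|) = 1`. -/
def IsCoprimeAut {G : Type*} [Group G] (α : MulAut G) : Prop :=
  Nat.Coprime (Nat.card G) (orderOf α)

/-- The finite group `G` is `p`-separable: there is a series `1 = N₀ ≤ N₁ ≤ ⋯ ≤ Nₙ = G` of
normal subgroups of `G` in which the order `|Nᵢ₊₁ : Nᵢ|` of each factor `Nᵢ₊₁ / Nᵢ` is a power
of `p` (the factor is a `p`-group) or is prime to `p` (the factor is a `p'`-group). -/
def IsPSeparable (p : ℕ) (G : Type*) [Group G] : Prop :=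
  ∃ (n : ℕ) (N : ℕ → Subgroup G),
    N 0 = ⊥ ∧ N n = ⊤ ∧ (∀ i ≤ n, (N i).Normal) ∧
      ∀ i < n, N i ≤ N (i + 1) ∧
        ((∃ k : ℕ, (N i).relIndex (N (i + 1)) = p ^ k) ∨
          Nat.Coprime p ((N i).relIndex (N (i + 1))))

/-- `G` is `p`-closed: it has a normal Sylow `p`-subgroup. -/
def IsPClosed (p : ℕ) (G : Type*) [Group G] : Prop :=
  ∃ P : Sylow p G, (P : Subgroup G).Normal

/-!
Everything is phrased for an endomorphism `α` of a finite group `G` with `α ^ r = 1`, where `r` is a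
prime not dividing `|G|`, and an `α`-invariant Sylow `p`-subgroup `P` with `C_P(α) = 1` that is
normalized by `C_G(α)`. This situation (`CoprimeConfig`) passes to `α`-invariant subgroups
containing `P` and to quotients by `α`-invariant normal subgroups `N`: an invariant coset of `N` has
`|N|` elements, a number prime to `r`, so it contains a fixed point.

Consider a minimal counterexample to the normality of `P`. If `N ≠ 1` is normal and invariant, then
`PN` is normal by minimality of `G` applied to `G / N`; if `PN < G`, then `P` is normal in `PN`, hence
in `G` by the Frattini argument. So `G = PN` for every such `N`. By `p`-separability some such `N` is
a `p`-group, and then `P = G`, or has order prime to `p`, and then `G = PN` with `N` a normal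
`p`-complement. In the second case, for each prime `q ≠ p` there is a Sylow `q`-subgroup `Q` that is
both `P`-invariant and `α`-invariant: `N_G(P)` permutes the `P`-invariant ones transitively, so their
number is prime to `r` (`CoprimeConfig.exists_invariant_sylow`). If `PQ < G`, then `Q` normalizes `P`
by minimality. If `PQ = G`, then `Q` is normal, so `G = P Z(Q)` and it suffices that `P` centralizes
`Z(Q)`. In all cases `N_G(P)` contains a Sylow subgroup for every prime, so it is `G`.

That `P` centralizes an abelian normal invariant `p'`-subgroup `V` is the one computation
(`map_pow_card_eq_of_frobenius_action`). It compares two evaluations of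
`∏ x ∈ P, ∏ i < r, (x α^i x⁻¹) v`. The inner products are norms of `α`, so they are fixed by `α`, and
`C_V(α) ≤ C_V(P)`. On the other hand `x α^i x⁻¹ = x α^i(x)⁻¹ · α^i`, and for `0 < i < r` the element
`x α^i(x)⁻¹` runs once through `P`, because `α^i` has no nontrivial fixed point in `P`; so each of
these terms is a product over a `P`-orbit. The term `i = 0` is `v ^ |P|`, which is therefore fixed by
`P`, and every element of `V` is a `|P|`-th power.
-/

/-! ### Fixed points of maps of prime order -/

theorem exists_apply_eq_self_of_iterate_eq {X : Type*} [Finite X] {r : ℕ} (hr : r.Prime)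
    (f : X → X) (hf : ∀ x, f^[r] x = x) (hX : ¬ r ∣ Nat.card X) : ∃ x, f x = x := by
  classical
  have := Fintype.ofFinite X
  have : Fact r.Prime := ⟨hr⟩
  have hbij : Function.Bijective f := by
    have h : f^[r] = id := funext hf
    obtain ⟨k, rfl⟩ : ∃ k, r = k + 1 := ⟨r - 1, (Nat.succ_pred_prime hr).symm⟩
    refine ⟨Function.Injective.of_comp (f := f^[k]) ?_, Function.Surjective.of_comp (g := f^[k]) ?_⟩
    · rw [← Function.iterate_succ, h]; exact Function.injective_id
    · rw [← Function.iterate_succ', h]; exact Function.surjective_id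
  refine Equiv.Perm.exists_fixed_point_of_prime (p := r) (n := 1)
    (σ := Equiv.ofBijective f hbij) (by rwa [← Nat.card_eq_fintype_card]) ?_
  ext x
  rw [pow_one, Equiv.Perm.one_apply, ← Equiv.Perm.iterate_eq_pow]
  exact hf x

theorem exists_mem_apply_eq_self_of_iterate_eq {X : Type*} {r : ℕ} (hr : r.Prime)
    (f : X → X) (hf : ∀ x, f^[r] x = x) (S : Set X) [Finite S] (hS : Set.MapsTo f S S)
    (hcard : ¬ r ∣ Nat.card S) : ∃ x ∈ S, f x = x := by
  obtain ⟨x, hx⟩ := exists_apply_eq_self_of_iterate_eq hr (hS.restrict f S S)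
    (fun x => Subtype.ext (by rw [hS.iterate_restrict, Set.MapsTo.val_restrict_apply, hf])) hcard
  exact ⟨x, x.2, congrArg Subtype.val hx⟩

/-- A coset `gN` that `α` maps to itself contains a fixed point of `α`. -/
theorem exists_fixed_mem_coset {G : Type*} [Group G] [Finite G] {r : ℕ} (hr : r.Prime) (α : G →* G)
    (hα : ∀ g, α^[r] g = g) (hcop : r.Coprime (Nat.card G)) (N : Subgroup G)
    (hN : ∀ x ∈ N, α x ∈ N) {g : G} (hg : g⁻¹ * α g ∈ N) : ∃ c, g⁻¹ * c ∈ N ∧ α c = c := by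
  let e : {x | g⁻¹ * x ∈ N} ≃ N :=
    { toFun := fun x => ⟨g⁻¹ * x, x.2⟩
      invFun := fun y => ⟨g * y, by simp⟩
      left_inv := fun x => by simp
      right_inv := fun y => by simp }
  refine exists_mem_apply_eq_self_of_iterate_eq hr α hα {x | g⁻¹ * x ∈ N} ?_ ?_
  · intro x hx
    have := N.mul_mem hg (hN _ hx)
    simpa [mul_assoc] using this
  · rw [Nat.card_congr e]
    exact fun h => hr.one_lt.ne' (Nat.dvd_one.1 (hcop.gcd_eq_one ▸ Nat.dvd_gcd dvd_rfl
      (h.trans N.card_subgroup_dvd_card)))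

theorem apply_eq_self_of_iterate_eq_self {X : Type*} {r i : ℕ} (hr : r.Prime) {f : X → X} {x : X}
    (hx : f^[r] x = x) (hi : 0 < i) (hir : i < r) (hix : f^[i] x = x) : f x = x := by
  have h : Function.IsPeriodicPt f (r.gcd i) x := Function.IsPeriodicPt.gcd hx hix
  rwa [(hr.coprime_iff_not_dvd.2 (Nat.not_dvd_of_pos_of_lt hi hir)).gcd_eq_one] at h

/-! ### Frobenius actions on abelian groups -/

theorem bijective_mul_inv_apply {P : Type*} [Group P] [Finite P] (β : P →* P)
    (hβ : ∀ x, β x = x → x = 1) : Function.Bijective fun x => x * (β x)⁻¹ := by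
  refine Finite.injective_iff_bijective.1 fun x y h => ?_
  have : y⁻¹ * x = 1 := hβ _ (by
    have h' : x * (β x)⁻¹ = y * (β y)⁻¹ := h
    rw [mul_inv_eq_iff_eq_mul] at h'
    rw [map_mul, map_inv]
    conv_rhs => rw [h']
    simp [mul_assoc])
  exact (inv_mul_eq_one.1 this).symm

/-- If `P` acts on the abelian group `V`, compatibly with automorphisms `α` of `P` and `a` of `V`
whose `r`-th powers are trivial, `α` has no nontrivial fixed point, and `P` fixes the fixed points
of `a`, then `P` fixes all `|P|`-th powers in `V`. -/
theorem map_pow_card_eq_of_frobenius_action {V P : Type*} [CommGroup V] [Group P] [Fintype P]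
    {r : ℕ} (hr : r.Prime) (α : P →* P) (hα : ∀ x, α^[r] x = x) (hfree : ∀ x, α x = x → x = 1)
    (a : V →* V) (ha : ∀ v, a^[r] v = v) (φ : P →* MulAut V)
    (hφ : ∀ x v, a (φ x v) = φ (α x) (a v)) (hfix : ∀ v, a v = v → ∀ x, φ x v = v)
    (y : P) (v : V) : φ y (v ^ Fintype.card P) = v ^ Fintype.card P := by
  have hit : ∀ i x u, a^[i] (φ x u) = φ (α^[i] x) (a^[i] u) := by
    intro i
    induction i with
    | zero => intro x u; rfl
    | succ i ih => intro x u; simp only [Function.iterate_succ_apply, hφ, ih]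
  obtain ⟨k, rfl⟩ : ∃ k, r = k + 1 := ⟨r - 1, (Nat.succ_pred_prime hr).symm⟩
  -- Norms along the automorphism are fixed by it, hence by the whole group.
  have hnorm : ∀ u x, φ x (∏ i ∈ Finset.range (k + 1), a^[i] u)
      = ∏ i ∈ Finset.range (k + 1), a^[i] u := by
    refine fun u => hfix _ ?_
    rw [map_prod]
    simp only [← Function.iterate_succ_apply' (f := a)]
    rw [Finset.prod_range_succ, ha, Finset.prod_range_succ' (fun i => a^[i] u)]
    rfl
  have horb : ∀ u, φ y (∏ x, φ x u) = ∏ x, φ x u := by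
    intro u
    rw [map_prod]
    exact Fintype.prod_equiv (Equiv.mulLeft y) _ _ fun x => by simp
  have hiter : ∀ i, ∃ β : P →* P, ∀ x, β x = α^[i] x := fun i =>
    ⟨{ toFun := α^[i], map_one' := iterate_map_one α i, map_mul' := iterate_map_mul α i },
      fun _ => rfl⟩
  -- For `i ≥ 1` the inner product is over a whole orbit; the factor for `i = 0` is the power of `v`.
  have key : ∏ x, ∏ i ∈ Finset.range (k + 1), a^[i] (φ x⁻¹ v)
      = v ^ Fintype.card P * ∏ i ∈ Finset.range k, ∏ x, φ x (a^[i + 1] v) := by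
    have h1 : ∀ x, ∏ i ∈ Finset.range (k + 1), a^[i] (φ x⁻¹ v)
        = ∏ i ∈ Finset.range (k + 1), φ (x * (α^[i] x)⁻¹) (a^[i] v) := by
      intro x
      rw [← hnorm _ x, map_prod]
      refine Finset.prod_congr rfl fun i _ => ?_
      rw [hit, map_mul, iterate_map_inv]
      rfl
    rw [Finset.prod_congr rfl fun x _ => h1 x, Finset.prod_comm, Finset.prod_range_succ', mul_comm]
    congr 1
    · simp
    · refine Finset.prod_congr rfl fun i hi => ?_
      obtain ⟨β, hβ⟩ := hiter (i + 1)
      have hb := bijective_mul_inv_apply β fun x hx => hfree x <|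
        apply_eq_self_of_iterate_eq_self hr (hα x) i.succ_pos
          (by have := Finset.mem_range.1 hi; omega) ((hβ x).symm.trans hx)
      exact Fintype.prod_bijective _ hb _ _ fun x => by rw [← hβ]
  rw [← mul_inv_eq_iff_eq_mul] at key
  rw [← key, map_mul, map_inv, map_prod, map_prod]
  congr 1
  · exact Finset.prod_congr rfl fun x _ => hnorm _ _
  · congr 1
    exact Finset.prod_congr rfl fun i _ => horb _

/-! ### Separability and invariant normal subgroups -/

section

universe u

open Subgroup

variable {G : Type u} [Group G]

theorem relIndex_inf_dvd_relIndex (A B H : Subgroup G) [A.Normal] :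
    A.relIndex (B ⊓ H) ∣ A.relIndex B := by
  rw [← relIndex_subgroupOf (inf_le_left : B ⊓ H ≤ B)]
  exact relIndex_dvd_index_of_normal _ _

theorem relIndex_map_dvd_relIndex {G' : Type*} [Group G'] (f : G →* G') (A B : Subgroup G)
    [A.Normal] (h : A ≤ B) : (A.map f).relIndex (B.map f) ∣ A.relIndex B := by
  rw [relIndex_map_map]
  have : B ⊔ f.ker = B ⊔ (A ⊔ f.ker) := by rw [← sup_assoc, sup_eq_left.2 h]
  rw [this, relIndex_sup_right]
  exact relIndex_dvd_of_le_left _ le_sup_left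

theorem pow_or_coprime_of_dvd {p a b : ℕ} (hp : p.Prime) (hab : a ∣ b)
    (h : (∃ k : ℕ, b = p ^ k) ∨ Nat.Coprime p b) : (∃ k : ℕ, a = p ^ k) ∨ Nat.Coprime p a := by
  rcases h with ⟨k, rfl⟩ | h
  · obtain ⟨j, -, hj⟩ := (Nat.dvd_prime_pow hp).1 hab
    exact Or.inl ⟨j, hj⟩
  · exact Or.inr (h.coprime_dvd_right hab)

theorem IsPSeparable.subgroup {p : ℕ} (hp : p.Prime) (h : IsPSeparable p G) (H : Subgroup G) :
    IsPSeparable p H := by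
  obtain ⟨n, N, h0, hn, hnor, hstep⟩ := h
  refine ⟨n, fun i => (N i).subgroupOf H, by simp [h0], by simp [hn],
    fun i hi => (hnor i hi).subgroupOf H, fun i hi => ⟨?_, ?_⟩⟩
  · exact comap_mono (hstep i hi).1
  · have := hnor i hi.le
    refine pow_or_coprime_of_dvd hp ?_ (hstep i hi).2
    dsimp only
    rw [subgroupOf, relIndex_comap, subgroupOf_map_subtype]
    exact relIndex_inf_dvd_relIndex _ _ _

theorem IsPSeparable.of_surjective {p : ℕ} (hp : p.Prime) (h : IsPSeparable p G) {G' : Type*}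
    [Group G'] (f : G →* G') (hf : Function.Surjective f) : IsPSeparable p G' := by
  obtain ⟨n, N, h0, hn, hnor, hstep⟩ := h
  refine ⟨n, fun i => (N i).map f, by simp [h0], by simp [hn, map_top_of_surjective f hf],
    fun i hi => (hnor i hi).map f hf, fun i hi => ⟨map_mono (hstep i hi).1, ?_⟩⟩
  have := hnor i hi.le
  exact pow_or_coprime_of_dvd hp (relIndex_map_dvd_relIndex f _ _ (hstep i hi).1) (hstep i hi).2

theorem IsPSeparable.exists_normal_ne_bot {p : ℕ} [Nontrivial G]
    (h : IsPSeparable p G) : ∃ N : Subgroup G, N.Normal ∧ N ≠ ⊥ ∧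
      (IsPGroup p N ∨ p.Coprime (Nat.card N)) := by
  classical
  obtain ⟨n, N, h0, hn, hnor, hstep⟩ := h
  have hex : ∃ i, N i ≠ ⊥ := ⟨n, by rw [hn]; exact top_ne_bot⟩
  have hle : Nat.find hex ≤ n := Nat.find_min' hex (by rw [hn]; exact top_ne_bot)
  obtain ⟨k, hk⟩ : ∃ k, Nat.find hex = k + 1 :=
    Nat.exists_eq_succ_of_ne_zero fun h => Nat.find_spec hex (h ▸ h0)
  have hbot : N k = ⊥ := not_not.1 (Nat.find_min hex (by omega))
  have hs := (hstep k (by omega)).2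
  rw [hbot, relIndex_bot_left] at hs
  refine ⟨N (k + 1), hnor _ (by omega), hk ▸ Nat.find_spec hex, hs.imp_left ?_⟩
  rintro ⟨j, hj⟩
  exact IsPGroup.of_card hj

/-- If normal subgroups with a property that `α` preserves are closed under joins, then a maximal
one is `α`-invariant. -/
theorem exists_invariant_normal [Finite G] (α : G →* G) (hα : Function.Surjective α)
    (C : Subgroup G → Prop) (hsup : ∀ H K : Subgroup G, H.Normal → K.Normal → C H → C K → C (H ⊔ K))
    (hmap : ∀ H : Subgroup G, C H → C (H.map α)) {N : Subgroup G} (hN : N.Normal) (hCN : C N) :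
    ∃ M : Subgroup G, N ≤ M ∧ M.Normal ∧ C M ∧ ∀ x ∈ M, α x ∈ M := by
  obtain ⟨M, hNM, hM⟩ := (Set.toFinite {H : Subgroup G | H.Normal ∧ C H}).exists_le_maximal
    (a := N) ⟨hN, hCN⟩
  have hMn : M.Normal := hM.prop.1
  have hαM : (M.map α).Normal := hMn.map α hα
  have hle : M.map α ⊔ M ≤ M :=
    hM.2 ⟨sup_normal _ _, hsup _ _ hαM hMn (hmap _ hM.prop.2) hM.prop.2⟩ le_sup_right
  exact ⟨M, hNM, hMn, hM.prop.2, fun x hx => hle (le_sup_left (a := M.map α) ⟨x, hx, rfl⟩)⟩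

theorem card_sup_dvd_mul_card (H K : Subgroup G) [K.Normal] :
    Nat.card (H ⊔ K : Subgroup G) ∣ Nat.card H * Nat.card K := by
  rw [← relIndex_bot_left, ← relIndex_mul_relIndex ⊥ K (H ⊔ K) bot_le le_sup_right,
    relIndex_bot_left, relIndex_sup_right, mul_comm]
  exact Nat.mul_dvd_mul_right (relIndex_dvd_card K H) _

/-- By the Frattini argument, a Sylow subgroup of `G` that is normal in a normal subgroup containing
it is normal in `G`. -/
theorem normal_of_normal_subtype [Finite G] {p : ℕ} [Fact p.Prime] (P : Sylow p G) {H : Subgroup G}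
    [H.Normal] (hPH : ↑P ≤ H) (hn : (P.subtype hPH : Subgroup H).Normal) :
    (P : Subgroup G).Normal := by
  rw [Sylow.coe_subtype, normal_subgroupOf_iff_le_normalizer hPH] at hn
  rw [← normalizer_eq_top_iff, ← Sylow.normalizer_sup_eq_top' P hPH]
  exact (sup_eq_left.2 hn).symm

theorem Subgroup.card_lt_of_ne_top [Finite G] {H : Subgroup G} (h : H ≠ ⊤) :
    Nat.card H < Nat.card G :=
  lt_of_le_of_ne (Nat.card_le_card_of_injective _ H.subtype_injective)
    fun h' => h (eq_top_of_card_eq H h')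

theorem Subgroup.card_quotient_lt_of_ne_bot [Finite G] {N : Subgroup G}
    (h : N ≠ ⊥) : Nat.card (G ⧸ N) < Nat.card G := by
  rw [N.card_eq_card_quotient_mul_card_subgroup]
  exact lt_mul_of_one_lt_right Nat.card_pos ((one_lt_card_iff_ne_bot N).2 h)

theorem Subgroup.forall_mem_sup_map_mem {α : G →* G} {H K : Subgroup G}
    (hH : ∀ x ∈ H, α x ∈ H) (hK : ∀ x ∈ K, α x ∈ K) : ∀ x ∈ H ⊔ K, α x ∈ H ⊔ K :=
  (sup_le (fun x hx => mem_sup_left (hH x hx)) fun x hx => mem_sup_right (hK x hx) :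
    H ⊔ K ≤ (H ⊔ K).comap α)

/-! ### Coprime configurations -/

/-- The restriction of the endomorphism `α` to a subgroup that it maps into itself. -/
def restrictEnd (α : G →* G) (H : Subgroup G) (hH : ∀ x ∈ H, α x ∈ H) : H →* H :=
  (α.domRestrict H).codRestrict H fun x => hH x x.2

theorem coe_restrictEnd (α : G →* G) {H : Subgroup G} (hH : ∀ x ∈ H, α x ∈ H) (x : H) :
    (restrictEnd α H hH x : G) = α x := rfl

theorem coe_iterate_restrictEnd (α : G →* G) {H : Subgroup G} (hH : ∀ x ∈ H, α x ∈ H) (n : ℕ)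
    (x : H) : ((restrictEnd α H hH)^[n] x : G) = α^[n] x :=
  (show Function.Semiconj ((↑) : H → G) (restrictEnd α H hH) α from
    fun _ => rfl).iterate_right n x

/-- The data of a coprime automorphism of prime order `r` and a Sylow subgroup as in the theorem:
`α` has order dividing `r`, which is prime to `|G|`, the Sylow `p`-subgroup `P` is `α`-invariant,
`C_P(α) = 1`, and `C_G(α)` normalizes `P`. Here `α` is an endomorphism and may be the identity, so
that the notion passes to sections of `G`. The number `r` is a prime wherever the notion is used, and
then `α` is bijective, because an iterate of it is the identity. -/
structure CoprimeConfig (p r : ℕ) (α : G →* G) (P : Sylow p G) : Prop where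
  iterate_eq : ∀ g, α^[r] g = g
  coprime : r.Coprime (Nat.card G)
  map_mem : ∀ x ∈ P, α x ∈ P
  fixed_eq_one : ∀ x ∈ P, α x = x → x = 1
  fixed_conj_mem : ∀ g, α g = g → ∀ x ∈ P, g * x * g⁻¹ ∈ P

namespace CoprimeConfig
variable {p r : ℕ} {α : G →* G} {P : Sylow p G}

theorem surjective (hr : r.Prime) (h : CoprimeConfig p r α P) : Function.Surjective α := by
  obtain ⟨k, rfl⟩ : ∃ k, r = k + 1 := ⟨r - 1, (Nat.succ_pred_prime hr).symm⟩
  exact fun g => ⟨α^[k] g, by rw [← Function.iterate_succ_apply' (f := α), h.iterate_eq]⟩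

theorem restrict [Finite G] (h : CoprimeConfig p r α P) {H : Subgroup G} (hPH : ↑P ≤ H)
    (hH : ∀ x ∈ H, α x ∈ H) : CoprimeConfig p r (restrictEnd α H hH) (P.subtype hPH) where
  iterate_eq g := Subtype.ext (by rw [coe_iterate_restrictEnd, h.iterate_eq])
  coprime := h.coprime.coprime_dvd_right H.card_subgroup_dvd_card
  map_mem x hx := h.map_mem x hx
  fixed_eq_one x hx hfix := Subtype.ext (h.fixed_eq_one x hx (congrArg Subtype.val hfix))
  fixed_conj_mem g hg x hx := h.fixed_conj_mem g (congrArg Subtype.val hg) x hx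

theorem quotient [Finite G] [Fact p.Prime] (hr : r.Prime) (h : CoprimeConfig p r α P)
    (N : Subgroup G) [N.Normal] (hN : ∀ x ∈ N, α x ∈ N) :
    CoprimeConfig p r (QuotientGroup.map N N α hN)
      (P.mapSurjective (QuotientGroup.mk'_surjective N)) where
  iterate_eq := by
    intro g
    obtain ⟨g, rfl⟩ := QuotientGroup.mk'_surjective N g
    have := (show Function.Semiconj (QuotientGroup.mk' N) α (QuotientGroup.map N N α hN) from
      fun _ => rfl).iterate_right r g
    rw [← this, h.iterate_eq]
  coprime := h.coprime.coprime_dvd_right N.card_quotient_dvd_card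
  map_mem := by
    rintro _ ⟨x, hx, rfl⟩
    exact ⟨α x, h.map_mem x hx, rfl⟩
  fixed_eq_one := by
    rintro _ ⟨x, hx, rfl⟩ hfix
    have hxN : x⁻¹ * α x ∈ N := QuotientGroup.eq.1 hfix.symm
    obtain ⟨c, hc, hαc⟩ := exists_fixed_mem_coset hr α h.iterate_eq h.coprime (N ⊓ P)
      (fun y hy => ⟨hN y hy.1, h.map_mem y hy.2⟩)
      (g := x) ⟨hxN, P.mul_mem (P.inv_mem hx) (h.map_mem x hx)⟩
    have hcP : c ∈ P := by
      have := P.mul_mem hx hc.2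
      rwa [mul_inv_cancel_left] at this
    have hc1 := h.fixed_eq_one c hcP hαc
    rw [hc1, mul_one] at hc
    exact (QuotientGroup.eq_one_iff x).2 (by simpa using N.inv_mem hc.1)
  fixed_conj_mem := by
    intro g hfix
    obtain ⟨g, rfl⟩ := QuotientGroup.mk'_surjective N g
    obtain ⟨c, hc, hαc⟩ := exists_fixed_mem_coset hr α h.iterate_eq h.coprime N hN
      (g := g) (QuotientGroup.eq.1 hfix.symm)
    have hgc : QuotientGroup.mk' N g = QuotientGroup.mk' N c := QuotientGroup.eq.2 hc
    rw [hgc]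
    rintro _ ⟨x, hx, rfl⟩
    exact ⟨c * x * c⁻¹, h.fixed_conj_mem c hαc x hx, by simp⟩

/-- `P` centralizes every abelian normal invariant subgroup `Z` of order prime to `p`. -/
theorem conj_eq_of_normal_commutative [Finite G] [Fact p.Prime] (hr : r.Prime)
    (h : CoprimeConfig p r α P) (Z : Subgroup G) [Z.Normal] (hZ : ∀ x ∈ Z, α x ∈ Z)
    (hcomm : ∀ x ∈ Z, ∀ y ∈ Z, x * y = y * x) (hcard : p.Coprime (Nat.card Z))
    {x z : G} (hx : x ∈ P) (hz : z ∈ Z) : x * z * x⁻¹ = z := by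
  classical
  have := Fintype.ofFinite (P : Subgroup G)
  let _ : CommGroup Z :=
    { (inferInstance : Group Z) with mul_comm := fun a b => Subtype.ext (hcomm a a.2 b b.2) }
  have hcop : (Nat.card Z).Coprime (Fintype.card (P : Subgroup G)) := by
    obtain ⟨n, hn⟩ := P.isPGroup'.exists_card_eq
    rw [← Nat.card_eq_fintype_card, hn]
    exact (hcard.pow_left n).symm
  have hdisj : ∀ y : G, y ∈ P → y ∈ Z → y = 1 := fun y hyP hyZ =>
    disjoint_def.1 (disjoint_of_coprime_natCard (H := Z) (K := P)
      (by rwa [Nat.card_eq_fintype_card (α := (P : Subgroup G))])) hyZ hyP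
  obtain ⟨w, hw⟩ := (powCoprime hcop).surjective ⟨z, hz⟩
  have key := map_pow_card_eq_of_frobenius_action hr (restrictEnd α P h.map_mem)
    (fun x => Subtype.ext (by rw [coe_iterate_restrictEnd, h.iterate_eq]))
    (fun x hx => Subtype.ext (h.fixed_eq_one x x.2 (congrArg Subtype.val hx)))
    (restrictEnd α Z hZ) (fun x => Subtype.ext (by rw [coe_iterate_restrictEnd, h.iterate_eq]))
    ((MulAut.conjNormal (H := Z)).comp (P : Subgroup G).subtype)
    (fun x v => Subtype.ext (by simp [coe_restrictEnd])) ?_ ⟨x, hx⟩ w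
  · have hw' : w ^ Fintype.card (P : Subgroup G) = ⟨z, hz⟩ := hw
    rw [hw'] at key
    simpa using congrArg Subtype.val key
  · intro v hv y
    have hv' : α v = v := congrArg Subtype.val hv
    refine Subtype.ext ?_
    -- The commutator of `v` and `y` lies in `P` and in `Z`, whose orders are coprime.
    have hP : v * (y : G) * (v : G)⁻¹ * (y : G)⁻¹ ∈ P :=
      P.mul_mem (h.fixed_conj_mem v hv' y y.2) (P.inv_mem y.2)
    have hv1 := hdisj _ hP (by
      have := Z.mul_mem v.2 (‹Z.Normal›.conj_mem _ (Z.inv_mem v.2) y)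
      simpa [mul_assoc] using this)
    have : (v : G) * y = y * v := by
      rw [mul_inv_eq_one, mul_inv_eq_iff_eq_mul] at hv1
      exact hv1
    simp [← this]

end CoprimeConfig

/-! ### Invariant Sylow subgroups -/

theorem iterate_mem_iterate_mapSurjective [Finite G] {q : ℕ} [Fact q.Prime] (α : G →* G)
    (hα : Function.Surjective α) (Q : Sylow q G) (n : ℕ) {x : G} (hx : x ∈ Q) :
    α^[n] x ∈ (fun R : Sylow q G => R.mapSurjective hα)^[n] Q := by
  induction n with
  | zero => exact hx
  | succ n ih =>
    rw [Function.iterate_succ_apply', Function.iterate_succ_apply']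
    exact ⟨_, ih, rfl⟩

/-- A normal subgroup of `p`-power index, given by a `p`-group supplementing it, contains the Sylow
`q`-subgroups for `q ≠ p`. -/
theorem Sylow.le_of_sup_eq_top [Finite G] {p q : ℕ} [Fact q.Prime] (hqp : q ≠ p) [Fact p.Prime]
    {P K : Subgroup G} [K.Normal] (hP : IsPGroup p P) (htop : P ⊔ K = ⊤) (Q : Sylow q G) :
    (Q : Subgroup G) ≤ K := by
  have hmap : (Q : Subgroup G).map (QuotientGroup.mk' K) = ⊥ := by
    refine le_bot_iff.1 ?_
    have h1 : (⊤ : Subgroup (G ⧸ K)) = P.map (QuotientGroup.mk' K) := by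
      rw [← map_top_of_surjective _ (QuotientGroup.mk'_surjective K), ← htop, Subgroup.map_sup,
        QuotientGroup.map_mk'_self, sup_bot_eq]
    have h2 := IsPGroup.disjoint_of_coprime (Q.2.map (QuotientGroup.mk' K))
      (hP.map (QuotientGroup.mk' K)) ((Nat.coprime_primes Fact.out Fact.out).2 hqp)
    rw [← h1] at h2
    exact h2 le_rfl le_top
  rw [Subgroup.map_eq_bot_iff, QuotientGroup.ker_mk'] at hmap
  exact hmap

/-- `N_G(P)` permutes transitively the Sylow `q`-subgroups that are normalized by the Sylow
`p`-subgroup `P`: if `P` and its conjugate `gPg⁻¹` both normalize `R`, they are conjugate in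
`N_G(R)`. -/
theorem mem_orbit_normalizer_of_le_normalizer [Finite G] {p q : ℕ} [Fact p.Prime] [Fact q.Prime]
    (P : Sylow p G) {Q R : Sylow q G} (hQ : ↑P ≤ normalizer (Q : Set G))
    (hR : ↑P ≤ normalizer (R : Set G)) :
    R ∈ MulAction.orbit (normalizer (P : Set G)) Q := by
  obtain ⟨g, hg⟩ := MulAction.exists_smul_eq G Q R
  have hgP : ↑(g • P) ≤ normalizer (R : Set G) := by
    rintro _ ⟨x, hx, rfl⟩
    have hx' := Sylow.smul_eq_iff_mem_normalizer.2 (hQ hx)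
    refine Sylow.smul_eq_iff_mem_normalizer.1 ?_
    change (g * x * g⁻¹) • R = R
    rw [← hg, smul_smul, inv_mul_cancel_right, mul_smul, hx']
  obtain ⟨h, hh⟩ := MulAction.exists_smul_eq (normalizer (R : Set G))
    ((g • P).subtype hgP) (P.subtype hR)
  simp_rw [Sylow.smul_subtype, Subgroup.smul_def, smul_smul] at hh
  refine ⟨⟨h * g, Sylow.smul_eq_iff_mem_normalizer.1 (Sylow.subtype_injective hh)⟩, ?_⟩
  change ((h : G) * g) • Q = R
  rw [mul_smul, hg]
  exact Sylow.smul_eq_iff_mem_normalizer.2 h.2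

namespace CoprimeConfig
variable {p r : ℕ} {α : G →* G} {P : Sylow p G}

/-- If `G = PK` with `K` normal of order prime to `p`, then for each prime `q ≠ p` some Sylow
`q`-subgroup is normalized by `P` and `α`-invariant. -/
theorem exists_invariant_sylow [Finite G] [Fact p.Prime] (hr : r.Prime)
    (h : CoprimeConfig p r α P) (K : Subgroup G) [K.Normal] (hK : p.Coprime (Nat.card K))
    (htop : ↑P ⊔ K = ⊤) {q : ℕ} [Fact q.Prime] (hqp : q ≠ p) :
    ∃ Q : Sylow q G, ↑P ≤ normalizer (Q : Set G) ∧ ∀ x ∈ Q, α x ∈ Q := by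
  have hsurj := h.surjective hr
  have hα := h.restrict le_rfl h.map_mem
  have hPsurj := hα.surjective hr
  -- The number of Sylow `q`-subgroups divides `|K|`, so the `p`-group `P` fixes one of them.
  obtain ⟨Q₀, hQ₀⟩ : ∃ Q : Sylow q G, ↑P ≤ normalizer (Q : Set G) := by
    obtain ⟨Q, hQ⟩ := P.2.nonempty_fixed_point_of_prime_not_dvd_card (Sylow q G) (by
      let Q : Sylow q G := default
      have hN := Sylow.normalizer_sup_eq_top' Q (Sylow.le_of_sup_eq_top hqp P.2 htop Q)
      rw [Q.card_eq_index_normalizer]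
      intro hdvd
      have h1 : (normalizer (Q : Set G)).index ∣ Nat.card K := by
        have := card_sup_dvd_mul_card (normalizer (Q : Set G)) K
        rw [hN, card_top, ← card_mul_index (normalizer (Q : Set G))] at this
        exact Nat.dvd_of_mul_dvd_mul_left Nat.card_pos this
      exact (Fact.out : p.Prime).one_lt.ne' (Nat.dvd_one.1 (hK.gcd_eq_one ▸ Nat.dvd_gcd dvd_rfl
        (hdvd.trans h1))))
    exact ⟨Q, (sylow_mem_fixedPoints_iff _).1 hQ⟩
  have hnorm : ∀ g : normalizer (P : Set G), ↑P ≤ normalizer ((g • Q₀ : Sylow q G) : Set G) := by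
    rintro ⟨g, hg⟩ x hx
    have hx' := Sylow.smul_eq_iff_mem_normalizer.2 (hQ₀ ((mem_normalizer_iff''.1 hg x).1 hx))
    refine Sylow.smul_eq_iff_mem_normalizer.1 ?_
    change x • g • Q₀ = g • Q₀
    conv_rhs => rw [← hx']
    simp only [smul_smul, mul_assoc, mul_inv_cancel_left]
  have hmaps : Set.MapsTo (fun R : Sylow q G => R.mapSurjective hsurj)
      (MulAction.orbit (normalizer (P : Set G)) Q₀)
      (MulAction.orbit (normalizer (P : Set G)) Q₀) := by
    rintro _ ⟨g, rfl⟩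
    refine mem_orbit_normalizer_of_le_normalizer P hQ₀ fun x hx => ?_
    obtain ⟨⟨y, hy⟩, hyx⟩ := hPsurj ⟨x, hx⟩
    have hyx : α y = x := congrArg Subtype.val hyx
    refine mem_normalizer_fintype ?_
    rintro _ ⟨t, ht, rfl⟩
    exact ⟨y * t * y⁻¹, (mem_normalizer_iff.1 (hnorm g hy) t).1 ht, by simp [hyx]⟩
  have hcard : ¬ r ∣ Nat.card (MulAction.orbit (normalizer (P : Set G)) Q₀) := by
    have hdvd : Nat.card (MulAction.orbit (normalizer (P : Set G)) Q₀) ∣ Nat.card G := by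
      refine dvd_trans ?_ (normalizer (P : Set G)).card_subgroup_dvd_card
      rw [Nat.card_coe_set_eq, ← MulAction.index_stabilizer]
      exact index_dvd_card _
    exact fun hdvd' => hr.one_lt.ne' (Nat.dvd_one.1 (h.coprime.gcd_eq_one ▸
      Nat.dvd_gcd dvd_rfl (hdvd'.trans hdvd)))
  obtain ⟨Q, hQ, hfix⟩ := exists_mem_apply_eq_self_of_iterate_eq hr
    (fun R : Sylow q G => R.mapSurjective hsurj)
    (fun R => Sylow.ext (R.is_maximal' (Sylow.isPGroup' _) fun x hx => by
      have := iterate_mem_iterate_mapSurjective α hsurj R r hx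
      rwa [h.iterate_eq] at this))
    (MulAction.orbit (normalizer (P : Set G)) Q₀) hmaps hcard
  refine ⟨Q, ?_, fun x hx => ?_⟩
  · obtain ⟨g, rfl⟩ := hQ
    exact hnorm g
  · have : α x ∈ Q.mapSurjective hsurj := ⟨x, hx, rfl⟩
    rwa [hfix] at this

end CoprimeConfig

/-! ### The minimal counterexample -/

/-- `P` is normal in a coprime configuration on a `p`-separable group, by induction on the order
`n` of the group. -/
theorem CoprimeConfig.normal {p r : ℕ} [Fact p.Prime] (hr : r.Prime) (n : ℕ) :
    ∀ (G : Type u) [Group G] [Finite G] (α : G →* G) (P : Sylow p G), Nat.card G = n →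
      CoprimeConfig p r α P → IsPSeparable p G → (P : Subgroup G).Normal := by
  have hp : p.Prime := Fact.out
  induction n using Nat.strong_induction_on with
  | _ n ih =>
  intro G _ _ α P hcard h hsep
  subst hcard
  by_contra hP
  have hsub : ∀ H : Subgroup G, H ≠ ⊤ → ∀ hPH : ↑P ≤ H, (∀ x ∈ H, α x ∈ H) →
      (P.subtype hPH : Subgroup H).Normal := fun H hH hPH hα =>
    ih _ (card_lt_of_ne_top hH) H _ _ rfl (h.restrict hPH hα) (hsep.subgroup hp H)
  -- In a minimal counterexample every nontrivial invariant normal subgroup supplements `P`.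
  have hsupp : ∀ N : Subgroup G, N.Normal → N ≠ ⊥ → (∀ x ∈ N, α x ∈ N) → ↑P ⊔ N = ⊤ := by
    intro N hN hNbot hNα
    by_contra hne
    have hnq := ih _ (card_quotient_lt_of_ne_bot hNbot) (G ⧸ N) _ _ rfl (h.quotient hr N hNα)
      (hsep.of_surjective hp _ (QuotientGroup.mk'_surjective N))
    have : (↑P ⊔ N).Normal := by
      have := hnq.comap (QuotientGroup.mk' N)
      rwa [Sylow.coe_mapSurjective, QuotientGroup.comap_map_mk', sup_comm] at this
    exact hP (normal_of_normal_subtype P le_sup_left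
      (hsub _ hne le_sup_left (forall_mem_sup_map_mem h.map_mem hNα)))
  have hinj : Function.Injective α := Finite.injective_iff_surjective.2 (h.surjective hr)
  have hnt : Nontrivial G := by
    by_contra hnt
    rw [not_nontrivial_iff_subsingleton] at hnt
    exact hP ((Subsingleton.elim (⊤ : Subgroup G) P) ▸ inferInstance)
  obtain ⟨N, hNn, hNbot, hN | hN⟩ := hsep.exists_normal_ne_bot
  · obtain ⟨M, hNM, hMn, hM, hMα⟩ := exists_invariant_normal α (h.surjective hr)
      (fun H => IsPGroup p H) (fun H K _ _ hH hK => hH.to_sup_of_normal_right hK)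
      (fun H hH => hH.map α) hNn hN
    have := hsupp M hMn (ne_bot_of_le_ne_bot hNbot hNM) hMα
    rw [sup_eq_left.2 (hM.le_sylow_of_normal P)] at this
    exact hP (this ▸ inferInstance)
  obtain ⟨K, hNK, hKn, hK, hKα⟩ := exists_invariant_normal α (h.surjective hr)
    (fun H => p.Coprime (Nat.card H))
    (fun H K _ _ hH hK => (hH.mul_right hK).coprime_dvd_right (card_sup_dvd_mul_card H K))
    (fun H hH => hH.coprime_dvd_right (card_map_dvd H α)) hNn hN
  have htop := hsupp K hKn (ne_bot_of_le_ne_bot hNbot hNK) hKα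
  -- It suffices that the normalizer of `P` contains a Sylow subgroup for every prime.
  suffices hall : ∀ q : ℕ, q.Prime → ∃ Q : Sylow q G, (Q : Subgroup G) ≤ normalizer (P : Set G) by
    refine hP (normalizer_eq_top_iff.1 (index_eq_one.1 ?_))
    by_contra hne
    obtain ⟨q, hq, hdvd⟩ := Nat.exists_prime_and_dvd hne
    have : Fact q.Prime := ⟨hq⟩
    obtain ⟨Q, hQ⟩ := hall q hq
    exact Q.not_dvd_index (hdvd.trans (index_dvd_of_le hQ))
  intro q hq
  have : Fact q.Prime := ⟨hq⟩
  by_cases hqp : q = p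
  · subst hqp
    exact ⟨P, le_normalizer⟩
  obtain ⟨Q, hPQ, hQα⟩ := h.exists_invariant_sylow hr K hK htop hqp
  refine ⟨Q, ?_⟩
  by_cases hne : ↑P ⊔ ↑Q = (⊤ : Subgroup G)
  · -- Now `Q` is normal, and its center supplements `P`.
    have hQn : (Q : Subgroup G).Normal := by
      rw [← normalizer_eq_top_iff, eq_top_iff, ← hne]
      exact sup_le hPQ le_normalizer
    by_cases hQbot : (Q : Subgroup G) = ⊥
    · rw [hQbot]; exact bot_le
    have hcop : p.Coprime (Nat.card Q) := by
      obtain ⟨k, hk⟩ := Q.2.exists_card_eq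
      rw [hk]
      exact ((Nat.coprime_primes hp hq).2 (Ne.symm hqp)).pow_right k
    -- `Z` is the center of `Q`, as a subgroup of `G`.
    let Z : Subgroup G := ↑Q ⊓ centralizer (Q : Set G)
    have hZ : ∀ x ∈ Z, α x ∈ Z := by
      rintro x ⟨hxQ, hxc⟩
      refine ⟨hQα x hxQ, mem_centralizer_iff.2 fun y hy => ?_⟩
      -- `α` is injective on the finite group `Q`, hence maps it onto itself.
      obtain ⟨⟨t, ht⟩, hty⟩ := Finite.surjective_of_injective (f := restrictEnd α Q hQα)
        (fun a b hab => Subtype.ext (hinj (congrArg Subtype.val hab))) ⟨y, hy⟩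
      have hty : α t = y := congrArg Subtype.val hty
      rw [← hty, ← map_mul, ← map_mul, mem_centralizer_iff.1 hxc t ht]
    have hZbot : Z ≠ ⊥ := by
      have : Nontrivial Q := (nontrivial_iff_ne_bot _).2 hQbot
      have := Q.2.center_nontrivial
      obtain ⟨z, hz⟩ := exists_ne (1 : center Q)
      refine fun hbot => hz (Subtype.ext (Subtype.ext ((mem_bot (G := G)).1 (hbot.le ⟨z.1.2, ?_⟩))))
      exact mem_centralizer_iff.2 fun y hy =>
        congrArg Subtype.val (mem_center_iff.1 z.2 ⟨y, hy⟩)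
    have hZn : Z.Normal := by
      have : (centralizer (Q : Set G)).Normal := normal_centralizer (H := (Q : Subgroup G))
      exact normal_inf_normal _ _
    have hZtop := hsupp Z hZn hZbot hZ
    refine (hP (normalizer_eq_top_iff.1 (eq_top_iff.2 ?_))).elim
    rw [← hZtop]
    refine sup_le le_normalizer fun z hz => mem_normalizer_fintype fun x hx => ?_
    have hxz := h.conj_eq_of_normal_commutative hr Z hZ
      (fun a ha b hb => mem_centralizer_iff.1 hb.2 a ha.1)
      (hcop.coprime_dvd_right (card_dvd_of_le inf_le_left)) hx hz
    rw [mul_inv_eq_iff_eq_mul] at hxz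
    rwa [← hxz, mul_inv_cancel_right]
  · have := hsub _ hne le_sup_left (forall_mem_sup_map_mem h.map_mem hQα)
    rw [Sylow.coe_subtype, normal_subgroupOf_iff_le_normalizer le_sup_left] at this
    exact le_sup_right.trans this

end

theorem mainTheorem5 {G : Type*} [Group G] [Finite G] (p : ℕ) [Fact p.Prime]
    (α : MulAut G) (hα : IsCoprimeAut α) (hα_prime : (orderOf α).Prime)
    (P : Sylow p G) (hP : (P : Subgroup G).map α.toMonoidHom = (P : Subgroup G))
    (hp : p ∉ primesOf (fixedSubgroup α))
    (hsep : IsPSeparable p G)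
    (hnorm : fixedSubgroup α ≤ Subgroup.normalizer ((P : Subgroup G) : Set G)) :
    IsPClosed p G := by
  have hpp : p.Prime := Fact.out
  have hconf : CoprimeConfig p (orderOf α) α.toMonoidHom P :=
    { iterate_eq := by
        intro g
        have hpow : ∀ n : ℕ, α.toMonoidHom^[n] g = (α ^ n) g := by
          intro n
          induction n with
          | zero => rfl
          | succ n ih => rw [Function.iterate_succ_apply', ih, pow_succ']; rfl
        rw [hpow, pow_orderOf_eq_one]
        rfl
      coprime := hα.symm
      map_mem := fun x hx => hP.le ⟨x, hx, rfl⟩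
      fixed_eq_one := by
        intro x hx hfix
        by_contra hx1
        -- A nontrivial fixed point in `P` has order a positive power of `p`.
        refine hp (Nat.mem_primeFactors.2 ⟨hpp, ?_, Nat.card_pos.ne'⟩)
        obtain ⟨k, hk⟩ := IsPGroup.iff_orderOf.1 P.2 ⟨x, hx⟩
        rw [Subgroup.orderOf_mk] at hk
        have hk0 : k ≠ 0 := by
          rintro rfl
          exact hx1 (orderOf_eq_one_iff.1 (by simpa using hk))
        have : orderOf x ∣ Nat.card (fixedSubgroup α) :=
          Subgroup.orderOf_dvd_natCard _ (show x ∈ fixedSubgroup α from hfix)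
        exact (dvd_pow_self p hk0).trans (hk ▸ this)
      fixed_conj_mem := fun g hg x hx =>
        (Subgroup.mem_normalizer_iff.1 (hnorm (show g ∈ fixedSubgroup α from hg)) x).1 hx }
  exact ⟨P, CoprimeConfig.normal hα_prime _ G _ P rfl hconf hsep⟩
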